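/- All vector spaces are real. A \emph{contraction} between normed spaces is a linear map $\varphi$ with $\|\varphi(x)\|\le\|x\|$; a \emph{contractive map} between metric spaces is a map with $d(\varphi(x),\varphi(y))\le d(x,y)$. A linear map $\varphi\colon E\to F$ between Banach lattices is \emph{almost interval preserving} if it is positive and $[0,\varphi(x)]=\overline{\varphi([0,x])}$ for all $x\ge 0$. Consider the chain of categories \[ \mathrm{BL}_{\mathrm{AIPLH}}\subset \mathrm{BL}_{\mathrm{LH}}\subset \mathrm{POBS}_{\mathrm{Pos}}\subset \mathrm{BS}\subset \mathrm{ComMet}, \] where $\mathrm{BL}_{\mathrm{AIPLH}}$ has the Banach lattices and the contractive almost interval preserving vector lattice homomorphisms; $\mathrm{BL}_{\mathrm{LH}}$ the Banach lattices and the contractive vector lattice homomorphisms; $\mathrm{POBS}_{\mathrm{Pos}}$ the preordered Banach spaces (Banach spaces with a linear preorder whose positive wedge is closed; the wedge need be neither a cone nor generating) and the positive contractions; $\mathrm{BS}$ the Banach spaces and the contractions; and $\mathrm{ComMet}$ the complete metric spaces and the contractive maps. Direct systems are indexed by non-empty directed preordered sets $I$; a direct limit is a colimit. \textbf{Theorem.}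 Let $\mathrm{Cat}$ be $\mathrm{BL}_{\mathrm{AIPLH}}$, $\mathrm{BL}_{\mathrm{LH}}$ or $\mathrm{BS}$, and let $(E_i)_{i\in I}$, with connecting morphisms $\varphi_{ji}\colon E_i\to E_j$ $(i\le j)$, be a direct system in $\mathrm{Cat}$. (1) The system has a direct limit in $\mathrm{Cat}$. One is given as follows. Let $\widetilde E=\{(e_i)\in\prod_iE_i:\sup_i\|e_i\|<\infty\}$ with the supremum norm, let $\widetilde E_0=\{(e_i)\in\widetilde E:\lim_i\|e_i\|=0\}$, which is a closed subspace, and let $q\colon\widetilde E\to\widetilde E/\widetilde E_0$ be the quotient map. Define $\psi_i\colon E_i\to\widetilde E$ by $(\psi_i(x))_j=\varphi_{ji}(x)$ if $j\ge i$ and $(\psi_i(x))_j=0$ otherwise, and put $\varphi_i=q\circ\psi_i$. Then $E=\overline{\bigcup_i\varphi_i(E_i)}\subseteq\widetilde E/\widetilde E_0$, with the maps $\varphi_i\colon E_i\to E$, is a direct limit in $\mathrm{Cat}$; in the two lattice cases $E$ carries the order in which $x\le y$ if and only if $x=q(f)$ and $y=q(g)$ for some $f,g\in\widetilde E$ with $f_i\le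 g_i$ for all $i$. (2) If $(E,(\varphi_i))$ is any direct limit of the system in $\mathrm{Cat}$, then $E=\overline{\bigcup_i\varphi_i(E_i)}$ and $\varphi_i(E_i)\subseteq\varphi_j(E_j)$ when $i\le j$. Moreover, the $\varphi_i(E_i)$ are linear subspaces of $E$; they are vector sublattices of $E$ when $\mathrm{Cat}$ is $\mathrm{BL}_{\mathrm{LH}}$ or $\mathrm{BL}_{\mathrm{AIPLH}}$; and the closures $\overline{\varphi_i(E_i)}$ are ideals in $E$ when $\mathrm{Cat}=\mathrm{BL}_{\mathrm{AIPLH}}$. (3) Every direct limit of the system in $\mathrm{Cat}$ is also a direct limit of the system in every larger category of the chain above. -/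

import Mathlib

open CategoryTheory CategoryTheory.Limits Topology Filter Set
open scoped ENNReal

universe v u

noncomputable section

/-! ### The categories -/

/-- Complete metric spaces. -/
structure ComMet : Type (u + 1) where
  carrier : Type u
  [metric : MetricSpace carrier]
  [complete : CompleteSpace carrier]

/-- Real Banach spaces. -/
structure BS : Type (u + 1) where
  carrier : Type u
  [normed : NormedAddCommGroup carrier]
  [space : NormedSpace ℝ carrier]
  [complete : CompleteSpace carrier]

/-- Preordered Banach spaces: a Banach space with a linear preorder whose positive wedge
`{x | 0 ≤ x}` is norm closed. The wedge need be neither a cone nor generating. -/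
structure POBS : Type (u + 1) where
  carrier : Type u
  [normed : NormedAddCommGroup carrier]
  [space : NormedSpace ℝ carrier]
  [complete : CompleteSpace carrier]
  [preorder : Preorder carrier]
  [orderedAdd : IsOrderedAddMonoid carrier]
  [orderedSMul : IsOrderedModule ℝ carrier]
  isClosed_nonneg : IsClosed {x : carrier | 0 ≤ x}

/-- Banach lattices, as the objects of the category with contractive lattice homomorphisms. -/
structure BLLH : Type (u + 1) where
  carrier : Type u
  [normed : NormedAddCommGroup carrier]
  [space : NormedSpace ℝ carrier]
  [complete : CompleteSpace carrier]
  [lattice : Lattice carrier]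
  [orderedAdd : IsOrderedAddMonoid carrier]
  [orderedSMul : IsOrderedModule ℝ carrier]
  [solid : HasSolidNorm carrier]

/-- Banach lattices, as the objects of the category with contractive almost interval preserving
lattice homomorphisms. -/
structure BLAIPLH : Type (u + 1) where
  toBLLH : BLLH.{u}

instance : CoeSort ComMet.{u} (Type u) := ⟨ComMet.carrier⟩
instance : CoeSort BS.{u} (Type u) := ⟨BS.carrier⟩
instance : CoeSort POBS.{u} (Type u) := ⟨POBS.carrier⟩
instance : CoeSort BLLH.{u} (Type u) := ⟨BLLH.carrier⟩
instance : CoeSort BLAIPLH.{u} (Type u) := ⟨fun X => X.toBLLH.carrier⟩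

attribute [instance] ComMet.metric ComMet.complete
attribute [instance] BS.normed BS.space BS.complete
attribute [instance] POBS.normed POBS.space POBS.complete POBS.preorder POBS.orderedAdd
  POBS.orderedSMul
attribute [instance] BLLH.normed BLLH.space BLLH.complete BLLH.lattice BLLH.orderedAdd
  BLLH.orderedSMul BLLH.solid

/-- Contractive maps between metric spaces. -/
@[ext] structure ComMet.Hom (X Y : ComMet.{u}) where
  toFun : X → Y
  dist_le : ∀ x y, dist (toFun x) (toFun y) ≤ dist x y

/-- Linear contractions. -/
@[ext] structure BS.Hom (X Y : BS.{u}) where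
  toLin : X →ₗ[ℝ] Y
  norm_le : ∀ x, ‖toLin x‖ ≤ ‖x‖

/-- Positive contractions. -/
@[ext] structure POBS.Hom (X Y : POBS.{u}) where
  toLin : X →ₗ[ℝ] Y
  norm_le : ∀ x, ‖toLin x‖ ≤ ‖x‖
  nonneg : ∀ x, 0 ≤ x → 0 ≤ toLin x

/-- Contractive vector lattice homomorphisms. -/
@[ext] structure BLLH.Hom (X Y : BLLH.{u}) where
  toLin : X →ₗ[ℝ] Y
  norm_le : ∀ x, ‖toLin x‖ ≤ ‖x‖
  map_sup : ∀ x y, toLin (x ⊔ y) = toLin x ⊔ toLin y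
  map_inf : ∀ x y, toLin (x ⊓ y) = toLin x ⊓ toLin y

/-- A linear map from a vector lattice to a normed lattice is almost interval preserving if it is
positive and maps `[0, x]` onto a dense subset of `[0, φ x]` for every `x ≥ 0`. -/
def AlmostIntervalPreserving {E F : Type*} [AddCommGroup E] [Module ℝ E] [Lattice E]
    [NormedAddCommGroup F] [NormedSpace ℝ F] [Lattice F] (φ : E →ₗ[ℝ] F) : Prop :=
  (∀ x, 0 ≤ x → 0 ≤ φ x) ∧ ∀ x, 0 ≤ x → Icc 0 (φ x) = closure (φ '' Icc 0 x)

instance : Category ComMet.{u} where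
  Hom := ComMet.Hom
  id X := ⟨id, fun _ _ => le_rfl⟩
  comp f g := ⟨g.toFun ∘ f.toFun, fun x y => (g.dist_le _ _).trans (f.dist_le x y)⟩

instance : Category BS.{u} where
  Hom := BS.Hom
  id X := ⟨LinearMap.id, fun _ => le_rfl⟩
  comp f g := ⟨g.toLin ∘ₗ f.toLin, fun x => (g.norm_le _).trans (f.norm_le x)⟩

instance : Category POBS.{u} where
  Hom := POBS.Hom
  id X := ⟨LinearMap.id, fun _ => le_rfl, fun _ h => h⟩
  comp f g := ⟨g.toLin ∘ₗ f.toLin, fun x => (g.norm_le _).trans (f.norm_le x),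
    fun x hx => g.nonneg _ (f.nonneg x hx)⟩

instance : Category BLLH.{u} where
  Hom := BLLH.Hom
  id X := ⟨LinearMap.id, fun _ => le_rfl, fun _ _ => rfl, fun _ _ => rfl⟩
  comp f g := ⟨g.toLin ∘ₗ f.toLin, fun x => (g.norm_le _).trans (f.norm_le x),
    fun x y => by simp [f.map_sup, g.map_sup], fun x y => by simp [f.map_inf, g.map_inf]⟩

/-- Contractive almost interval preserving vector lattice homomorphisms. -/
@[ext] structure BLAIPLH.Hom (X Y : BLAIPLH.{u}) where
  toHom : X.toBLLH ⟶ Y.toBLLH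
  aip : AlmostIntervalPreserving toHom.toLin

theorem BS.Hom.continuous {X Y : BS.{u}} (f : BS.Hom X Y) : Continuous f.toLin :=
  (f.toLin.mkContinuous 1 fun x => by simpa using f.norm_le x).continuous

theorem BLLH.Hom.continuous {X Y : BLLH.{u}} (f : BLLH.Hom X Y) : Continuous f.toLin :=
  (f.toLin.mkContinuous 1 fun x => by simpa using f.norm_le x).continuous

theorem BLLH.Hom.nonneg {X Y : BLLH.{u}} (f : BLLH.Hom X Y) (x : X) (hx : 0 ≤ x) :
    0 ≤ f.toLin x := by
  have h := f.map_sup x 0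
  rw [sup_eq_left.2 hx, map_zero] at h
  rw [h]; exact le_sup_right

instance : Category BLAIPLH.{u} where
  Hom := BLAIPLH.Hom
  id X := ⟨𝟙 X.toBLLH, fun _ h => h, fun x _ => by
    change Icc 0 x = closure (id '' Icc 0 x)
    rw [image_id, isClosed_Icc.closure_eq]⟩
  comp {X Y Z} f g := ⟨f.toHom ≫ g.toHom, fun x hx => g.aip.1 _ (f.aip.1 x hx), fun x hx => by
    have hg : Continuous g.toHom.toLin := BLLH.Hom.continuous g.toHom
    change Icc 0 (g.toHom.toLin (f.toHom.toLin x)) =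
      closure ((g.toHom.toLin ∘ f.toHom.toLin) '' Icc 0 x)
    rw [g.aip.2 _ (f.aip.1 x hx), f.aip.2 x hx, image_comp]
    exact (closure_image_closure hg)⟩

/-! ### The chain of supercategories -/

/-- The inclusion of the category of Banach lattices and contractive almost interval preserving
lattice homomorphisms into that of Banach lattices and contractive lattice homomorphisms. -/
def BLAIPLH.toLH : BLAIPLH.{u} ⥤ BLLH.{u} where
  obj X := X.toBLLH
  map f := f.toHom

/-- Every Banach lattice is a preordered Banach space (its positive cone is closed), and every
lattice homomorphism is positive. -/
def BLLH.toPOBS : BLLH.{u} ⥤ POBS.{u} where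
  obj X := { carrier := X, isClosed_nonneg := isClosed_Ici }
  map f := ⟨f.toLin, f.norm_le, BLLH.Hom.nonneg f⟩

def POBS.toBS : POBS.{u} ⥤ BS.{u} where
  obj X := { carrier := X }
  map f := ⟨f.toLin, f.norm_le⟩

def BS.toComMet : BS.{u} ⥤ ComMet.{u} where
  obj X := { carrier := X }
  map f := ⟨f.toLin, fun x y => by
    rw [dist_eq_norm, dist_eq_norm, ← map_sub]; exact f.norm_le _⟩

def BLLH.toBS : BLLH.{u} ⥤ BS.{u} := BLLH.toPOBS ⋙ POBS.toBS

/-! ### Substructures -/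

/-- A subset of a real vector space is a linear subspace. -/
def IsLinearSubspace {E : Type*} [AddCommGroup E] [Module ℝ E] (S : Set E) : Prop :=
  ∃ W : Submodule ℝ E, (W : Set E) = S

/-- A vector sublattice: a linear subspace closed under finite suprema and infima. -/
def IsVectorSublattice {E : Type*} [AddCommGroup E] [Module ℝ E] [Lattice E] (S : Set E) : Prop :=
  IsLinearSubspace S ∧ ∀ x ∈ S, ∀ y ∈ S, x ⊔ y ∈ S ∧ x ⊓ y ∈ S

/-- An (order) ideal of a vector lattice: a solid linear subspace. -/
def IsVectorLatticeIdeal {E : Type*} [AddCommGroup E] [Module ℝ E] [Lattice E] (S : Set E) : Prop :=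
  IsLinearSubspace S ∧ LatticeOrderedAddCommGroup.IsSolid S

/-- The image `φ i (E i)` of a system `(E, φ)` compatible with a direct system in `BLAIPLH`. -/
def BLAIPLH.image {I : Type v} [Preorder I] {F : I ⥤ BLAIPLH.{u}} (c : Cocone F) (i : I) :
    Set c.pt := range fun x : F.obj i => (c.ι.app i).toHom.toLin x

/-- The image `φ i (E i)` of a system `(E, φ)` compatible with a direct system in `BLLH`. -/
def BLLH.image {I : Type v} [Preorder I] {F : I ⥤ BLLH.{u}} (c : Cocone F) (i : I) :
    Set c.pt := range fun x : F.obj i => (c.ι.app i).toLin x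

/-- The image `φ i (E i)` of a system `(E, φ)` compatible with a direct system in `BS`. -/
def BS.image {I : Type v} [Preorder I] {F : I ⥤ BS.{u}} (c : Cocone F) (i : I) :
    Set c.pt := range fun x : F.obj i => (c.ι.app i).toLin x

/-! ### The standard construction -/

section Standard

variable {I : Type v} [Preorder I] (F : I ⥤ BS.{max u v})

/-- The bounded families in `∏ i, E i`, with the supremum norm. -/
abbrev BoundedProduct : Type (max u v) := lp (fun i => (F.obj i : Type (max u v))) ∞

/-- The bounded families `e` with `lim_i ‖e i‖ = 0`. -/
def nullNets : Submodule ℝ (BoundedProduct.{v, u} F) where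
  carrier := {e | Tendsto (fun i => ‖e i‖) atTop (𝓝 0)}
  zero_mem' := by
    change Tendsto (fun i => ‖(0 : F.obj i)‖) atTop (𝓝 0)
    simpa using tendsto_const_nhds
  add_mem' {a b} ha hb := by
    refine squeeze_zero (fun _ => norm_nonneg _) (fun i => ?_) (by simpa using ha.add hb)
    simpa using norm_add_le (a i) (b i)
  smul_mem' c a ha := by
    have := ha.const_mul ‖c‖
    simpa [norm_smul] using this

instance nullNets_isClosed :
    IsClosed (nullNets.{v, u} F : Set (BoundedProduct.{v, u} F)) := by
  refine isClosed_of_closure_subset fun e he => ?_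
  change Tendsto (fun i => ‖e i‖) atTop (𝓝 0)
  rw [Metric.tendsto_nhds]
  intro ε hε
  obtain ⟨f, hf, hef⟩ := Metric.mem_closure_iff.1 he (ε / 2) (half_pos hε)
  have hf' : Tendsto (fun i => ‖f i‖) atTop (𝓝 0) := hf
  filter_upwards [Metric.tendsto_nhds.1 hf' (ε / 2) (half_pos hε)] with i hi
  rw [dist_eq_norm] at hef
  have h1 : ‖e i - f i‖ ≤ ‖e - f‖ := lp.norm_apply_le_norm (by simp) (e - f) i
  have h2 : ‖e i‖ ≤ ‖e i - f i‖ + ‖f i‖ := by simpa using norm_add_le (e i - f i) (f i)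
  simp only [dist_zero_right, norm_norm] at hi ⊢
  linarith

open Classical in
/-- The family whose `j`-th coordinate is the image of `x : E i` in `E j` if `i ≤ j`, and `0`
otherwise. -/
def stdFamily (i : I) (x : F.obj i) (j : I) : F.obj j :=
  if h : i ≤ j then (F.map (homOfLE h)).toLin x else 0

/-- The map sending `x : E i` to the bounded family `stdFamily F i x`. -/
def stdPsi (i : I) : F.obj i →ₗ[ℝ] BoundedProduct.{v, u} F where
  toFun x := ⟨stdFamily.{v, u} F i x, memℓp_infty ⟨‖x‖, by
    rintro _ ⟨j, rfl⟩
    dsimp only [stdFamily]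
    split_ifs with h
    · exact (F.map (homOfLE h)).norm_le x
    · simp⟩⟩
  map_add' x y := by
    ext j
    change stdFamily.{v, u} F i (x + y) j = stdFamily.{v, u} F i x j + stdFamily.{v, u} F i y j
    by_cases h : i ≤ j <;> simp [stdFamily, h]
  map_smul' c x := by
    ext j
    change stdFamily.{v, u} F i (c • x) j = c • stdFamily.{v, u} F i x j
    by_cases h : i ≤ j <;> simp [stdFamily, h]

theorem stdPsi_of_le {i j : I} (h : i ≤ j) (x : F.obj i) :
    stdPsi.{v, u} F i x j = (F.map (homOfLE h)).toLin x := dif_pos h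

theorem stdPsi_of_not_le {i j : I} (h : ¬ i ≤ j) (x : F.obj i) :
    stdPsi.{v, u} F i x j = 0 := dif_neg h

/-- The maps `E i → (bounded product) ⧸ (null nets)`. -/
def stdPhi (i : I) : F.obj i →ₗ[ℝ] BoundedProduct.{v, u} F ⧸ nullNets.{v, u} F :=
  (nullNets.{v, u} F).mkQ ∘ₗ stdPsi.{v, u} F i

/-- The closure of the union of the images of the maps `stdPhi F i`
(see `coe_stdSpace`; the union of the images of a direct system is a linear subspace). -/
def stdSpace : Submodule ℝ (BoundedProduct.{v, u} F ⧸ nullNets.{v, u} F) :=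
  (⨆ i, LinearMap.range (stdPhi.{v, u} F i)).topologicalClosure

theorem stdPhi_mem (i : I) (x : F.obj i) : stdPhi.{v, u} F i x ∈ stdSpace.{v, u} F :=
  Submodule.le_topologicalClosure _ (Submodule.mem_iSup_of_mem i ⟨x, rfl⟩)

theorem norm_stdPhi_le (i : I) (x : F.obj i) : ‖stdPhi.{v, u} F i x‖ ≤ ‖x‖ := by
  refine (Submodule.Quotient.norm_mk_le (nullNets.{v, u} F) (stdPsi.{v, u} F i x)).trans ?_
  refine lp.norm_le_of_forall_le (norm_nonneg x) fun j => ?_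
  by_cases h : i ≤ j
  · rw [stdPsi_of_le F h]; exact (F.map (homOfLE h)).norm_le x
  · rw [stdPsi_of_not_le F h]; simp

theorem stdPhi_map [IsDirectedOrder I] {i j : I} (h : i ⟶ j) (x : F.obj i) :
    stdPhi.{v, u} F j ((F.map h).toLin x) = stdPhi.{v, u} F i x := by
  refine (Submodule.Quotient.eq _).2 ?_
  change Tendsto _ atTop (𝓝 0)
  refine tendsto_const_nhds.congr' ?_
  filter_upwards [eventually_ge_atTop j] with k hk
  have hik : i ≤ k := (leOfHom h).trans hk
  have : (F.map (homOfLE hik)).toLin x = (F.map (homOfLE hk)).toLin ((F.map h).toLin x) := by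
    have h2 : homOfLE hik = h ≫ homOfLE hk := Subsingleton.elim _ _
    rw [h2, F.map_comp]; rfl
  change 0 = ‖stdPsi.{v, u} F j _ k - stdPsi.{v, u} F i x k‖
  rw [stdPsi_of_le F hk, stdPsi_of_le F hik, this, sub_self, norm_zero]

theorem coe_stdSpace [IsDirectedOrder I] [Nonempty I] :
    (stdSpace.{v, u} F : Set (BoundedProduct.{v, u} F ⧸ nullNets.{v, u} F)) =
      closure (⋃ i, range (stdPhi.{v, u} F i)) := by
  have hd : Directed (· ≤ ·) fun i => LinearMap.range (stdPhi.{v, u} F i) := by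
    refine Monotone.directed_le ?_
    rintro i j h _ ⟨x, rfl⟩
    exact ⟨(F.map (homOfLE h)).toLin x, stdPhi_map.{v, u} F _ x⟩
  rw [stdSpace, Submodule.topologicalClosure_coe, Submodule.coe_iSup_of_directed _ hd]
  rfl

/-- The standard construction, as a system compatible with the direct system `F`. -/
def stdCocone [IsDirectedOrder I] : Cocone F where
  pt :=
    haveI : CompleteSpace (stdSpace.{v, u} F) :=
      (Submodule.isClosed_topologicalClosure _).completeSpace_coe
    { carrier := stdSpace.{v, u} F }
  ι :=
    { app := fun i => ⟨(stdPhi.{v, u} F i).codRestrict _ (stdPhi_mem.{v, u} F i),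
        norm_stdPhi_le.{v, u} F i⟩
      naturality := fun i j h => by
        apply BS.Hom.ext
        refine LinearMap.ext fun x => Subtype.ext ?_
        exact stdPhi_map.{v, u} F h x }

end Standard

/-- A system compatible with a direct system of Banach lattices is given by the standard
construction: as a compatible system of Banach spaces it is (isometrically and compatibly with the
structure maps) the standard one, and its order is the one induced by the quotient of the
coordinatewise order of the bounded product. -/
def IsStandardLattice {I : Type v} [Preorder I] [IsDirectedOrder I] {F : I ⥤ BLLH.{max u v}}
    (c : Cocone F) : Prop :=
  ∃ e : BLLH.toBS.mapCocone c ≅ stdCocone.{v, u} (F ⋙ BLLH.toBS), ∀ x y : c.pt,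
    x ≤ y ↔ ∃ f g : BoundedProduct.{v, u} (F ⋙ BLLH.toBS),
      (∀ i, LE.le (α := F.obj i) (f i) (g i)) ∧
      (nullNets.{v, u} (F ⋙ BLLH.toBS)).mkQ f = (e.hom.hom.toLin x).1 ∧
      (nullNets.{v, u} (F ⋙ BLLH.toBS)).mkQ g = (e.hom.hom.toLin y).1

end

/-! ### Completed direct limits of metric spaces -/

/-! The proof rests on a metric characterisation of direct limits. A compatible system of
contractions `φ i` behaves as a completed direct limit as soon as the union of the images is dense
and the distance between `φ i a` and `φ i b` is approached by the distances between the images of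
`a` and `b` further along the system (`IsMetricLimit`). Compatible contractions out of the `E i` are
then well defined and 1-Lipschitz on the dense union, hence extend uniquely to the limit
(`exists_lift`). Linearity and lattice identities are closed conditions that hold on the images, so
they pass to the extension. Positivity and almost interval preservation need approximation arguments
instead. Thus this one property gives the universal property in every category of the chain.

The standard construction has the property because the quotient norm of a class modulo null nets
sees only the tail of a family (`isDenseLimit_stdCocone`). For lattices, the positive parts on the
`E i` are compatible contractive maps, so they induce a positive part on the limit; this defines the
Banach lattice structure (`exists_lattice`). It agrees with the coordinatewise positive part modulo
null nets (`mkQ_posPartFamily`), which identifies the order. For almost interval preserving systems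
the structure maps and the factoring maps inherit that property.

Finally, any direct limit in the given category is isomorphic to the standard one. The isomorphism
and its inverse are contractions, so it is isometric and transports the characterisation
(`IsDenseLimit.of_iso`); density and the colimit property in all larger categories follow. -/

/-- A compatible family of maps `φ i` out of a direct system of metric spaces, such that the union
of the images is dense, and the distances of images are the limits of the distances along the
system. -/
structure IsMetricLimit {I : Type*} [Preorder I] {E : I → Type*} [∀ i, MetricSpace (E i)]
    {X : Type*} [MetricSpace X] (T : ∀ ⦃i j : I⦄, i ≤ j → E i → E j) (φ : ∀ i, E i → X) :
    Prop where
  compat : ∀ ⦃i j⦄ (h : i ≤ j) (a : E i), φ j (T h a) = φ i a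
  dense : Dense (⋃ i, range (φ i))
  exists_dist_lt : ∀ i (a b : E i) (ε : ℝ), 0 < ε →
    ∃ (j : I) (h : i ≤ j), dist (T h a) (T h b) < dist (φ i a) (φ i b) + ε

namespace IsMetricLimit

variable {I : Type*} [Preorder I] {E : I → Type*} [∀ i, MetricSpace (E i)]
  {X : Type*} [MetricSpace X] {T : ∀ ⦃i j : I⦄, i ≤ j → E i → E j} {φ : ∀ i, E i → X}

theorem exists_dist_map_lt (H : IsMetricLimit T φ) (x : X) {ε : ℝ} (hε : 0 < ε) :
    ∃ i a, dist x (φ i a) < ε := by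
  obtain ⟨y, hy, hxy⟩ := Metric.dense_iff.1 H.dense x ε hε
  obtain ⟨i, a, rfl⟩ := mem_iUnion.1 hxy
  exact ⟨i, a, by simpa [dist_comm] using hy⟩

theorem induction (H : IsMetricLimit T φ) {P : X → Prop} (hP : IsClosed {x | P x})
    (h : ∀ i a, P (φ i a)) (x : X) : P x := by
  have : closure (⋃ i, range (φ i)) ⊆ {x | P x} :=
    closure_minimal (iUnion_subset fun i => range_subset_iff.2 (h i)) hP
  exact this (H.dense x)

variable [IsDirectedOrder I]

/-- Since the system is directed, elements coming from different indices can be moved to a common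
one. A closed relation therefore needs checking only inside a single `E i`. -/
theorem induction₂ (H : IsMetricLimit T φ) {P : X → X → Prop}
    (hP : IsClosed {x : X × X | P x.1 x.2}) (h : ∀ i a b, P (φ i a) (φ i b)) (x y : X) :
    P x y := by
  refine H.induction (P := fun x => P x y) (hP.preimage (Continuous.prodMk_left y))
    (fun i a => ?_) x
  refine H.induction (P := fun y => P (φ i a) y) (hP.preimage (Continuous.prodMk_right _))
    (fun j b => ?_) y
  obtain ⟨k, hi, hj⟩ := exists_ge_ge i j
  rw [← H.compat hi, ← H.compat hj]
  exact h _ _ _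

theorem induction₃ (H : IsMetricLimit T φ) {P : X → X → X → Prop}
    (hP : IsClosed {x : X × X × X | P x.1 x.2.1 x.2.2})
    (h : ∀ i a b c, P (φ i a) (φ i b) (φ i c)) (x y z : X) : P x y z := by
  refine H.induction (P := fun x => P x y z) (hP.preimage (Continuous.prodMk_left (y, z)))
    (fun i a => ?_) x
  refine H.induction₂ (P := fun y z => P (φ i a) y z) (hP.preimage (Continuous.prodMk_right _))
    (fun j b c => ?_) y z
  obtain ⟨k, hi, hj⟩ := exists_ge_ge i j
  rw [← H.compat hi, ← H.compat hj, ← H.compat hj]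
  exact h _ _ _ _

/-- A compatible family of contractive maps into a complete space factors through the limit. -/
theorem exists_lift (H : IsMetricLimit T φ) {Z : Type*} [MetricSpace Z] [CompleteSpace Z]
    (f : ∀ i, E i → Z) (hf : ∀ i a b, dist (f i a) (f i b) ≤ dist a b)
    (hc : ∀ ⦃i j⦄ (h : i ≤ j) a, f j (T h a) = f i a) :
    ∃ g : X → Z, (∀ x y, dist (g x) (g y) ≤ dist x y) ∧ ∀ i a, g (φ i a) = f i a := by
  -- `f` does not change when its arguments are pushed along the system, whereas their distance
  -- drops to nearly that of their images in the limit.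
  have key : ∀ i a b, dist (f i a) (f i b) ≤ dist (φ i a) (φ i b) := by
    intro i a b
    refine le_of_forall_pos_lt_add fun ε hε => ?_
    obtain ⟨j, h, hj⟩ := H.exists_dist_lt i a b ε hε
    rw [← hc h, ← hc h]
    exact (hf _ _ _).trans_lt hj
  have key₂ : ∀ i j a b, dist (f i a) (f j b) ≤ dist (φ i a) (φ j b) := by
    intro i j a b
    obtain ⟨k, hi, hj⟩ := exists_ge_ge i j
    rw [← hc hi, ← hc hj, ← H.compat hi, ← H.compat hj]
    exact key _ _ _
  have hS : ∀ s : (⋃ i, range (φ i) : Set X), ∃ p : Σ i, E i, φ p.1 p.2 = s := by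
    rintro ⟨s, hs⟩
    obtain ⟨i, a, rfl⟩ := mem_iUnion.1 hs
    exact ⟨⟨i, a⟩, rfl⟩
  -- An arbitrary choice of representatives is harmless: by `key₂`, representatives of the same
  -- point have the same value under `f`.
  choose p hp using hS
  let g₀ : (⋃ i, range (φ i) : Set X) → Z := fun s => f (p s).1 (p s).2
  have hg₀ : LipschitzWith 1 g₀ := LipschitzWith.of_dist_le_mul fun s t => by
    simpa [hp, Subtype.dist_eq] using key₂ (p s).1 (p t).1 (p s).2 (p t).2
  have hext : ∀ i a, H.dense.extend g₀ (φ i a) = f i a := by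
    intro i a
    have hm : φ i a ∈ ⋃ i, range (φ i) := mem_iUnion.2 ⟨i, a, rfl⟩
    rw [show φ i a = ((⟨φ i a, hm⟩ : (⋃ i, range (φ i) : Set X)) : X) from rfl,
      Dense.extend_of_ind H.dense hg₀.uniformContinuous]
    have := key₂ (p ⟨φ i a, hm⟩).1 i (p ⟨φ i a, hm⟩).2 a
    rw [hp, dist_self] at this
    exact dist_le_zero.1 this
  have hcont : Continuous (H.dense.extend g₀) :=
    (Dense.uniformContinuous_extend H.dense hg₀.uniformContinuous).continuous
  refine ⟨H.dense.extend g₀, H.induction₂ ?_ fun i a b => ?_, hext⟩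
  · exact isClosed_le (by fun_prop) (by fun_prop)
  · rw [hext, hext]; exact key i a b

end IsMetricLimit

/-! ### Linear structure and lattice structure on a completed limit. -/

namespace IsMetricLimit

section Linear

variable {I : Type*} [Preorder I] {E : I → Type*}
  [∀ i, NormedAddCommGroup (E i)] [∀ i, NormedSpace ℝ (E i)]
  {X : Type*} [NormedAddCommGroup X] [NormedSpace ℝ X]
  {T : ∀ ⦃i j : I⦄, i ≤ j → E i → E j} {φ : ∀ i, E i →ₗ[ℝ] X}

/-- A compatible family of linear contractions into a Banach space factors through the limit. -/
theorem exists_linear_lift [IsDirectedOrder I] (H : IsMetricLimit T fun i => φ i) {Z : Type*} [NormedAddCommGroup Z]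
    [NormedSpace ℝ Z] [CompleteSpace Z] (f : ∀ i, E i →ₗ[ℝ] Z) (hf : ∀ i a, ‖f i a‖ ≤ ‖a‖)
    (hc : ∀ ⦃i j⦄ (h : i ≤ j) a, f j (T h a) = f i a) :
    ∃ g : X →ₗ[ℝ] Z, (∀ x, ‖g x‖ ≤ ‖x‖) ∧ ∀ i a, g (φ i a) = f i a := by
  obtain ⟨g, hg, hgf⟩ := H.exists_lift (fun i => f i)
    (fun i a b => by rw [dist_eq_norm, dist_eq_norm, ← map_sub]; exact hf _ _) hc
  have hcont : Continuous g :=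
    (LipschitzWith.of_dist_le_mul (K := 1) fun x y => by simpa using hg x y).continuous
  have hadd : ∀ x y, g (x + y) = g x + g y := H.induction₂
    (isClosed_eq (by fun_prop) (by fun_prop)) fun i a b => by
      rw [← map_add, hgf, hgf, hgf, map_add]
  have hsmul : ∀ (r : ℝ) x, g (r • x) = r • g x := fun r => H.induction
    (isClosed_eq (by fun_prop) (by fun_prop)) fun i a => by
      rw [← map_smul, hgf, hgf, map_smul]
  have h0 : g 0 = 0 := by simpa using hsmul 0 0
  refine ⟨⟨⟨g, hadd⟩, hsmul⟩, fun x => ?_, hgf⟩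
  simpa [h0] using hg x 0

/-- The norm of `φ i a` is at most that of every `T h a`, while `‖T h b‖` comes arbitrarily close to
`‖φ i b‖`. Norm comparisons valid all along the system thus survive in the limit. -/
theorem norm_le_norm {T : ∀ ⦃i j : I⦄, i ≤ j → E i →ₗ[ℝ] E j}
    (H : IsMetricLimit (fun _ _ h => T h) fun i => φ i)
    (hφ : ∀ i a, ‖φ i a‖ ≤ ‖a‖) {i : I} {a b : E i}
    (h : ∀ ⦃j⦄ (h : i ≤ j), ‖T h a‖ ≤ ‖T h b‖) : ‖φ i a‖ ≤ ‖φ i b‖ := by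
  refine le_of_forall_pos_lt_add fun ε hε => ?_
  obtain ⟨j, hj, hlt⟩ := H.exists_dist_lt i b 0 ε hε
  simp only [map_zero, dist_zero_right] at hlt
  have := H.compat hj a
  rw [← this]
  exact ((hφ _ _).trans (h hj)).trans_lt hlt

end Linear

section Lattice

variable {I : Type*} [Preorder I] [IsDirectedOrder I] {E : I → Type*}
  [∀ i, NormedAddCommGroup (E i)] [∀ i, NormedSpace ℝ (E i)] [∀ i, Lattice (E i)]
  [∀ i, IsOrderedAddMonoid (E i)] [∀ i, HasSolidNorm (E i)] [∀ i, IsOrderedModule ℝ (E i)]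
  {X : Type*} [NormedAddCommGroup X] [NormedSpace ℝ X]
  {T : ∀ ⦃i j : I⦄, i ≤ j → E i →ₗ[ℝ] E j} {φ : ∀ i, E i →ₗ[ℝ] X}

/-- A completed direct limit of normed lattices, with respect to lattice homomorphisms, is a
Banach lattice. -/
theorem exists_lattice [CompleteSpace X] (H : IsMetricLimit (fun _ _ h => T h) fun i => φ i)
    (hφ : ∀ i a, ‖φ i a‖ ≤ ‖a‖)
    (hT : ∀ ⦃i j⦄ (h : i ≤ j) a, T h (a ⊔ 0) = T h a ⊔ 0) :
    ∃ _ : Lattice X, IsOrderedAddMonoid X ∧ IsOrderedModule ℝ X ∧ HasSolidNorm X ∧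
      (∀ i a b, φ i (a ⊔ b) = φ i a ⊔ φ i b) ∧ ∀ i a b, φ i (a ⊓ b) = φ i a ⊓ φ i b := by
  obtain ⟨p, hp, hpφ⟩ := H.exists_lift (fun i a => φ i (a ⊔ 0))
    (fun i a b => by
      rw [dist_eq_norm, dist_eq_norm, ← map_sub]
      exact (hφ _ _).trans (norm_sup_sub_sup_le_norm a b 0))
    (fun i j h a => by rw [← hT]; exact H.compat h _)
  have hcont : Continuous p :=
    (LipschitzWith.of_dist_le_mul (K := 1) fun x y => by simpa using hp x y).continuous
  -- In a vector lattice `x ⊔ y = x + (y - x)⁺` and `x ⊓ y = x - (x - y)⁺`, so the extended positive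
  -- part `p` determines both operations and makes them continuous. Each lattice axiom is then a
  -- closed condition, checked on the images.
  let s : X → X → X := fun x y => x + p (y - x)
  let t : X → X → X := fun x y => x - p (x - y)
  have hs : Continuous fun x : X × X => s x.1 x.2 := by fun_prop
  have ht : Continuous fun x : X × X => t x.1 x.2 := by fun_prop
  have hs' : ∀ {Y : Type _} [TopologicalSpace Y] {f g : Y → X}, Continuous f → Continuous g →
      Continuous fun y => s (f y) (g y) := fun hf hg => hs.comp (hf.prodMk hg)
  have ht' : ∀ {Y : Type _} [TopologicalSpace Y] {f g : Y → X}, Continuous f → Continuous g →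
      Continuous fun y => t (f y) (g y) := fun hf hg => ht.comp (hf.prodMk hg)
  have hsφ : ∀ i a b, s (φ i a) (φ i b) = φ i (a ⊔ b) := fun i a b => by
    change φ i a + p (φ i b - φ i a) = _
    rw [← map_sub, hpφ, ← map_add, add_sup]
    simp [sup_comm]
  have htφ : ∀ i a b, t (φ i a) (φ i b) = φ i (a ⊓ b) := fun i a b => by
    change φ i a - p (φ i a - φ i b) = _
    rw [← map_sub, hpφ, ← map_sub, sub_eq_add_neg, neg_sup, add_inf]
    simp [inf_comm]
  let L : Lattice X :=
    letI : Max X := ⟨s⟩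
    letI : Min X := ⟨t⟩
    Lattice.mk'
      (H.induction₂ (isClosed_eq (hs' (by fun_prop) (by fun_prop)) (hs' (by fun_prop) (by fun_prop)))
        fun i a b => show s _ _ = s _ _ by simp only [hsφ, sup_comm])
      (H.induction₃ (isClosed_eq (hs' (hs' (by fun_prop) (by fun_prop)) (by fun_prop))
        (hs' (by fun_prop) (hs' (by fun_prop) (by fun_prop))))
        fun i a b c => show s (s _ _) _ = s _ (s _ _) by simp only [hsφ, sup_assoc])
      (H.induction₂ (isClosed_eq (ht' (by fun_prop) (by fun_prop)) (ht' (by fun_prop) (by fun_prop)))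
        fun i a b => show t _ _ = t _ _ by simp only [htφ, inf_comm])
      (H.induction₃ (isClosed_eq (ht' (ht' (by fun_prop) (by fun_prop)) (by fun_prop))
        (ht' (by fun_prop) (ht' (by fun_prop) (by fun_prop))))
        fun i a b c => show t (t _ _) _ = t _ (t _ _) by simp only [htφ, inf_assoc])
      (H.induction₂ (isClosed_eq (hs' (by fun_prop) (ht' (by fun_prop) (by fun_prop)))
        (by fun_prop))
        fun i a b => show s _ (t _ _) = _ by simp only [htφ, hsφ, sup_inf_self])
      (H.induction₂ (isClosed_eq (ht' (by fun_prop) (hs' (by fun_prop) (by fun_prop)))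
        (by fun_prop))
        fun i a b => show t _ (s _ _) = _ by simp only [htφ, hsφ, inf_sup_self])
  have hsL : ∀ x y : X, x ⊔ y = s x y := fun _ _ => rfl
  have hle : ∀ x y : X, x ≤ y ↔ p (y - x) = y - x := fun x y => by
    rw [← sup_eq_right, hsL, eq_sub_iff_add_eq']
  have hadd : IsOrderedAddMonoid X := by
    refine ⟨fun x y h z => ?_, fun x y h z => ?_⟩ <;>
    · rw [hle] at h ⊢
      simpa using h
  have hsmul : ∀ r : ℝ, 0 ≤ r → ∀ x, p (r • x) = r • p x := fun r hr =>
    H.induction (isClosed_eq (by fun_prop) (by fun_prop)) fun i a => by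
      rw [← map_smul, hpφ, hpφ, ← map_smul]
      congr 1
      refine le_antisymm (sup_le (smul_le_smul_of_nonneg_left le_sup_left hr)
        (smul_nonneg hr le_sup_right)) ?_
      rcases hr.eq_or_lt with rfl | hr
      · simp
      · rw [← le_inv_smul_iff_of_pos hr]
        refine sup_le ?_ (smul_nonneg (inv_nonneg.2 hr.le) le_sup_right)
        rw [le_inv_smul_iff_of_pos hr]
        exact le_sup_left
  refine ⟨L, hadd, ?_, ?_, fun i a b => (hsφ i a b).symm, fun i a b => (htφ i a b).symm⟩
  · have h0 : ∀ r : ℝ, 0 ≤ r → ∀ x : X, 0 ≤ x → 0 ≤ r • x := fun r hr x hx => by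
      rw [hle, sub_zero] at hx ⊢
      rw [hsmul r hr, hx]
    exact
      { smul_le_smul_of_nonneg_left := fun r hr x y hxy => by
          rw [← sub_nonneg, ← smul_sub]; exact h0 r hr _ (sub_nonneg.2 hxy)
        smul_le_smul_of_nonneg_right := fun x hx r r' hr => by
          rw [← sub_nonneg, ← sub_smul]; exact h0 _ (sub_nonneg.2 hr) _ hx }
  · have habsT : ∀ ⦃i j⦄ (h : i ≤ j) a, T h |a| = |T h a| := fun i j h a => by
      have h2 : ∀ {G : Type _} [AddCommGroup G] [Lattice G] [IsOrderedAddMonoid G] (x : G),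
          |x| = (x ⊔ 0) + (-x ⊔ 0) := fun x => (posPart_add_negPart x).symm
      rw [h2, h2, map_add, hT, hT, map_neg]
    -- Solidity is an implication, hence not visibly a closed condition. It is split into two closed
    -- ones, `‖|x|‖ = ‖x‖` and `‖|x| ⊓ |y|‖ ≤ ‖y‖`; if `|x| ≤ |y|`, the infimum is `|x|`.
    have habs : ∀ x, ‖s x (-x)‖ = ‖x‖ :=
      H.induction (isClosed_eq (hs' (by fun_prop) (by fun_prop)).norm (by fun_prop)) fun i a => by
        rw [← map_neg, hsφ]
        have h1 : ∀ ⦃j⦄ (h : i ≤ j), ‖T h (a ⊔ -a)‖ = ‖T h a‖ := fun j h => by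
          rw [← norm_abs_eq_norm (T h a), ← habsT]; rfl
        exact le_antisymm (H.norm_le_norm hφ fun j h => (h1 h).le)
          (H.norm_le_norm hφ fun j h => (h1 h).ge)
    have hinf : ∀ x y, ‖t (s x (-x)) (s y (-y))‖ ≤ ‖y‖ :=
      H.induction₂ (isClosed_le (ht' (hs' (by fun_prop) (by fun_prop))
        (hs' (by fun_prop) (by fun_prop))).norm (by fun_prop)) fun i a b => by
        rw [← map_neg, ← map_neg, hsφ, hsφ, htφ]
        refine H.norm_le_norm hφ fun j h => ?_
        have h0 : ∀ c, 0 ≤ c → 0 ≤ T h c := fun c hc => by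
          rw [← sup_eq_left.2 hc, hT]; exact le_sup_right
        change ‖T h (|a| ⊓ |b|)‖ ≤ ‖T h b‖
        refine norm_le_norm_of_abs_le_abs ?_
        rw [abs_of_nonneg (h0 _ (le_inf (abs_nonneg a) (abs_nonneg b))), ← habsT, ← sub_nonneg,
          ← map_sub]
        exact h0 _ (sub_nonneg.2 inf_le_right)
    refine ⟨fun x y hxy => ?_⟩
    rw [← habs x]
    have : s x (-x) = t (s x (-x)) (s y (-y)) := (inf_eq_left.2 hxy).symm
    rw [this]
    exact hinf x y

end Lattice

end IsMetricLimit

/-! ### Almost interval preserving maps: ideals and passage to the limit. -/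

/-- The closure of the image of an almost interval preserving lattice homomorphism is solid. -/
theorem AlmostIntervalPreserving.isVectorLatticeIdeal_closure_range {E F : Type*}
    [AddCommGroup E] [Module ℝ E] [Lattice E] [IsOrderedAddMonoid E]
    [NormedAddCommGroup F] [NormedSpace ℝ F] [Lattice F] [IsOrderedAddMonoid F] [HasSolidNorm F]
    {φ : E →ₗ[ℝ] F} (hφ : AlmostIntervalPreserving φ) (hsup : ∀ x y, φ (x ⊔ y) = φ x ⊔ φ y) :
    IsVectorLatticeIdeal (closure (range φ)) := by
  have hW : ((LinearMap.range φ).topologicalClosure : Set F) = closure (range φ) := by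
    rw [Submodule.topologicalClosure_coe, LinearMap.coe_range]
  refine ⟨⟨_, hW⟩, ?_⟩
  have habs : ∀ a, φ |a| = |φ a| := fun a => by
    change φ (a ⊔ -a) = φ a ⊔ -φ a
    rw [hsup, map_neg]
  have key : ∀ y ∈ closure (range φ), ∀ z, 0 ≤ z → z ≤ |y| → z ∈ closure (range φ) := by
    intro y hy z hz hzy
    rw [← closure_closure]
    rw [Metric.mem_closure_iff]
    intro ε hε
    obtain ⟨_, ⟨a, rfl⟩, ha⟩ := Metric.mem_closure_iff.1 hy ε hε
    -- Truncation puts `z` in `[0, φ |a|]`, which lies in the closure of the range. The error is at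
    -- most `‖|y| - |φ a|‖ ≤ ‖y - φ a‖`, because `z = z ⊓ |y|`.
    refine ⟨z ⊓ φ |a|, ?_, ?_⟩
    · have h1 : z ⊓ φ |a| ∈ Icc 0 (φ |a|) :=
        ⟨le_inf hz (hφ.1 _ (abs_nonneg a)), inf_le_right⟩
      rw [hφ.2 _ (abs_nonneg a)] at h1
      exact closure_mono (image_subset_range _ _) h1
    · nth_rewrite 1 [← inf_eq_left.2 hzy]
      rw [dist_eq_norm] at ha ⊢
      rw [inf_comm z, inf_comm z, habs]
      exact ((norm_inf_sub_inf_le_norm _ _ _).trans (norm_abs_sub_abs _ _)).trans_lt ha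
  intro y hy z hzy
  rw [← posPart_sub_negPart z, ← hW]
  refine Submodule.sub_mem _ ?_ ?_ <;> rw [← SetLike.mem_coe, hW]
  · exact key y hy _ (posPart_nonneg z) ((sup_le (le_abs_self z) (abs_nonneg z)).trans hzy)
  · exact key y hy _ (negPart_nonneg z) ((sup_le (neg_le_abs z) (abs_nonneg z)).trans hzy)

namespace IsMetricLimit

variable {I : Type*} [Preorder I] {E : I → Type*}
  [∀ i, NormedAddCommGroup (E i)] [∀ i, NormedSpace ℝ (E i)] [∀ i, Lattice (E i)]
  {X : Type*} [NormedAddCommGroup X] [NormedSpace ℝ X] [Lattice X]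
  {T : ∀ ⦃i j : I⦄, i ≤ j → E i → E j} {φ : ∀ i, E i →ₗ[ℝ] X}

/-- Taking positive parts is contractive and fixes `x`, so the positive part of an approximant is at
least as good. -/
theorem exists_nonneg_dist_map_lt [IsOrderedAddMonoid X] [HasSolidNorm X]
    (H : IsMetricLimit T fun i => φ i)
    (hsup : ∀ i a b, φ i (a ⊔ b) = φ i a ⊔ φ i b) {x : X} (hx : 0 ≤ x) {ε : ℝ} (hε : 0 < ε) :
    ∃ i a, 0 ≤ a ∧ dist x (φ i a) < ε := by
  obtain ⟨i, a, ha⟩ := H.exists_dist_map_lt x hε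
  refine ⟨i, a ⊔ 0, le_sup_right, ?_⟩
  nth_rewrite 1 [← sup_eq_left.2 hx]
  rw [hsup, map_zero, dist_eq_norm]
  rw [dist_eq_norm] at ha
  exact (norm_sup_sub_sup_le_norm _ _ _).trans_lt ha

/-- The target has only a closed wedge and no lattice operations, so positivity cannot be expressed
through `g (x ⊔ 0)`. It comes from approximating `x` by images of positive elements. -/
theorem lift_nonneg [IsOrderedAddMonoid X] [HasSolidNorm X]
    (H : IsMetricLimit T fun i => φ i)
    (hsup : ∀ i a b, φ i (a ⊔ b) = φ i a ⊔ φ i b) {Z : Type*} [TopologicalSpace Z] [Zero Z]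
    [Preorder Z] (hZ : IsClosed {z : Z | 0 ≤ z}) {g : X → Z} (hg : Continuous g)
    (hgφ : ∀ i a, 0 ≤ a → 0 ≤ g (φ i a)) {x : X} (hx : 0 ≤ x) : 0 ≤ g x := by
  have : x ∈ closure {y | 0 ≤ g y} := Metric.mem_closure_iff.2 fun ε hε => by
    obtain ⟨i, a, h0, ha⟩ := H.exists_nonneg_dist_map_lt hsup hx hε
    exact ⟨φ i a, hgφ i a h0, ha⟩
  exact (hZ.preimage hg).closure_subset this

theorem lift_sup [IsDirectedOrder I] [IsOrderedAddMonoid X] [HasSolidNorm X]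
    (H : IsMetricLimit T fun i => φ i)
    (hsup : ∀ i a b, φ i (a ⊔ b) = φ i a ⊔ φ i b) {Z : Type*} [NormedAddCommGroup Z]
    [Lattice Z] [IsOrderedAddMonoid Z] [HasSolidNorm Z] {g : X → Z} (hg : Continuous g)
    (hgφ : ∀ i a b, g (φ i (a ⊔ b)) = g (φ i a) ⊔ g (φ i b)) (x y : X) :
    g (x ⊔ y) = g x ⊔ g y :=
  H.induction₂ (P := fun x y => g (x ⊔ y) = g x ⊔ g y)
    (isClosed_eq (by fun_prop) (by fun_prop)) (fun i a b => by rw [← hsup, hgφ]) x y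

theorem lift_inf [IsDirectedOrder I] [IsOrderedAddMonoid X] [HasSolidNorm X]
    (H : IsMetricLimit T fun i => φ i)
    (hinf : ∀ i a b, φ i (a ⊓ b) = φ i a ⊓ φ i b) {Z : Type*} [NormedAddCommGroup Z]
    [Lattice Z] [IsOrderedAddMonoid Z] [HasSolidNorm Z] {g : X → Z} (hg : Continuous g)
    (hgφ : ∀ i a b, g (φ i (a ⊓ b)) = g (φ i a) ⊓ g (φ i b)) (x y : X) :
    g (x ⊓ y) = g x ⊓ g y :=
  H.induction₂ (P := fun x y => g (x ⊓ y) = g x ⊓ g y)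
    (isClosed_eq (by fun_prop) (by fun_prop)) (fun i a b => by rw [← hinf, hgφ]) x y

/-- The structure maps of a completed direct limit with respect to almost interval preserving
lattice homomorphisms are almost interval preserving. -/
theorem almostIntervalPreserving [IsDirectedOrder I] [IsOrderedAddMonoid X] [HasSolidNorm X]
    {T : ∀ ⦃i j : I⦄, i ≤ j → E i →ₗ[ℝ] E j}
    (H : IsMetricLimit (fun _ _ h => T h) fun i => φ i) (hφ : ∀ i a, ‖φ i a‖ ≤ ‖a‖)
    (hsup : ∀ i a b, φ i (a ⊔ b) = φ i a ⊔ φ i b)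
    (hinf : ∀ i a b, φ i (a ⊓ b) = φ i a ⊓ φ i b)
    (hT : ∀ ⦃i j⦄ (h : i ≤ j), AlmostIntervalPreserving (T h)) (i : I) :
    AlmostIntervalPreserving (φ i) := by
  have hpos : ∀ i a, 0 ≤ a → 0 ≤ φ i a := fun i a ha => by
    rw [← sup_eq_left.2 ha, hsup, map_zero]; exact le_sup_right
  have hmono : ∀ i a b, a ≤ b → φ i a ≤ φ i b := fun i a b hab => by
    rw [← sup_eq_right, ← hsup, sup_eq_right.2 hab]
  refine ⟨hpos i, fun x hx => subset_antisymm ?_ ?_⟩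
  · rintro y ⟨hy0, hyx⟩
    refine Metric.mem_closure_iff.2 fun ε hε => ?_
    obtain ⟨j₀, z₀, hz₀, hz₀y⟩ := H.exists_nonneg_dist_map_lt hsup hy0 (half_pos hε)
    obtain ⟨j, hij, hj⟩ := exists_ge_ge i j₀
    have hx' : φ j (T hij x) = φ i x := H.compat hij x
    obtain ⟨z, hz, hzy⟩ : ∃ z : E j, 0 ≤ z ∧ dist y (φ j z) < ε / 2 := by
      refine ⟨T hj z₀, (hT hj).1 _ hz₀, ?_⟩
      have : φ j (T hj z₀) = φ j₀ z₀ := H.compat hj z₀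
      rwa [this]
    -- Cutting `z` down to `[0, T hij x]` costs nothing since `y ≤ φ i x`. The hypothesis on `T hij`
    -- then brings it back, up to a small error, to an element of `[0, x]` at the original index.
    have hmem : z ⊓ T hij x ∈ Icc 0 (T hij x) := ⟨le_inf hz ((hT hij).1 x hx), inf_le_right⟩
    rw [(hT hij).2 x hx] at hmem
    obtain ⟨_, ⟨w, hw, rfl⟩, hwz⟩ := Metric.mem_closure_iff.1 hmem _ (half_pos hε)
    refine ⟨φ i w, ⟨w, hw, rfl⟩, ?_⟩
    have hw' : φ j (T hij w) = φ i w := H.compat hij w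
    rw [← hw']
    have h1 : dist y (φ j (z ⊓ T hij x)) < ε / 2 := by
      nth_rewrite 1 [← inf_eq_left.2 hyx]
      rw [hinf, hx', dist_eq_norm]
      rw [dist_eq_norm] at hzy
      exact (norm_inf_sub_inf_le_norm _ _ _).trans_lt hzy
    have h2 : dist (φ j (z ⊓ T hij x)) (φ j (T hij w)) < ε / 2 := by
      rw [dist_eq_norm] at hwz ⊢
      rw [← map_sub]
      exact (hφ _ _).trans_lt hwz
    linarith [dist_triangle y (φ j (z ⊓ T hij x)) (φ j (T hij w))]
  · refine closure_minimal ?_ isClosed_Icc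
    rintro _ ⟨w, hw, rfl⟩
    exact ⟨hpos i w hw.1, hmono i _ _ hw.2⟩

/-- A lattice homomorphism from a completed direct limit is almost interval preserving if its
compositions with the structure maps are. -/
theorem lift_almostIntervalPreserving [IsOrderedAddMonoid X] [HasSolidNorm X]
    (H : IsMetricLimit T fun i => φ i)
    (hsup : ∀ i a b, φ i (a ⊔ b) = φ i a ⊔ φ i b)
    {Z : Type*} [NormedAddCommGroup Z] [NormedSpace ℝ Z]
    [Lattice Z] [IsOrderedAddMonoid Z] [HasSolidNorm Z] {g : X →ₗ[ℝ] Z}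
    (hg : ∀ x, ‖g x‖ ≤ ‖x‖) (hgsup : ∀ x y, g (x ⊔ y) = g x ⊔ g y)
    (hgφ : ∀ i, AlmostIntervalPreserving (g ∘ₗ φ i)) : AlmostIntervalPreserving g := by
  have hpos : ∀ a, 0 ≤ a → 0 ≤ g a := fun a ha => by
    rw [← sup_eq_left.2 ha, hgsup, map_zero]; exact le_sup_right
  have hmono : ∀ a b, a ≤ b → g a ≤ g b := fun a b hab => by
    rw [← sup_eq_right, ← hgsup, sup_eq_right.2 hab]
  have hφpos : ∀ i a, 0 ≤ a → 0 ≤ φ i a := fun i a ha => by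
    rw [← sup_eq_left.2 ha, hsup, map_zero]; exact le_sup_right
  have hφmono : ∀ i a b, a ≤ b → φ i a ≤ φ i b := fun i a b hab => by
    rw [← sup_eq_right, ← hsup, sup_eq_right.2 hab]
  refine ⟨hpos, fun x hx => subset_antisymm ?_ ?_⟩
  · rintro z ⟨hz0, hzx⟩
    refine Metric.mem_closure_iff.2 fun ε hε => ?_
    have hε3 : 0 < ε / 3 := by positivity
    obtain ⟨i, a, ha0, ha⟩ := H.exists_nonneg_dist_map_lt hsup hx hε3
    have hmem : z ⊓ g (φ i a) ∈ Icc 0 (g (φ i a)) :=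
      ⟨le_inf hz0 (hpos _ (hφpos i a ha0)), inf_le_right⟩
    have hcl := (hgφ i).2 a ha0
    simp only [LinearMap.comp_apply] at hcl
    rw [hcl] at hmem
    obtain ⟨_, ⟨w, hw, rfl⟩, hwz⟩ := Metric.mem_closure_iff.1 hmem _ hε3
    simp only at hwz
    -- `φ i w` lies below `φ i a` but perhaps not below `x`, so it is truncated at `x`. As `φ i w =
    -- φ i a ⊓ φ i w`, the truncation moves it by at most `‖φ i a - x‖`. The three errors of `ε / 3`
    -- come from truncating `z`, choosing `w`, and this step.
    refine ⟨g (x ⊓ φ i w), ⟨_, ⟨le_inf hx (hφpos i w hw.1), inf_le_left⟩, rfl⟩, ?_⟩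
    have h1 : dist z (z ⊓ g (φ i a)) < ε / 3 := by
      nth_rewrite 1 [← inf_eq_left.2 hzx]
      rw [inf_comm z, inf_comm z, dist_eq_norm]
      rw [dist_eq_norm] at ha
      refine (norm_inf_sub_inf_le_norm _ _ _).trans_lt ?_
      rw [← map_sub]
      exact (hg _).trans_lt ha
    have h2 : dist (g (φ i w)) (g (x ⊓ φ i w)) < ε / 3 := by
      rw [dist_eq_norm, ← map_sub]
      refine (hg _).trans_lt ?_
      nth_rewrite 1 [← inf_eq_right.2 (hφmono i _ _ hw.2)]
      refine (norm_inf_sub_inf_le_norm _ _ _).trans_lt ?_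
      rwa [dist_comm, dist_eq_norm] at ha
    linarith [dist_triangle4 z (z ⊓ g (φ i a)) (g (φ i w)) (g (x ⊓ φ i w))]
  · refine closure_minimal ?_ isClosed_Icc
    rintro _ ⟨w, hw, rfl⟩
    exact ⟨hpos w hw.1, hmono _ _ hw.2⟩

end IsMetricLimit

theorem IsMetricLimit.comp_isometry {I : Type*} [Preorder I] {E : I → Type*}
    [∀ i, MetricSpace (E i)] {X Y : Type*} [MetricSpace X] [MetricSpace Y]
    {T : ∀ ⦃i j : I⦄, i ≤ j → E i → E j} {φ : ∀ i, E i → X} (H : IsMetricLimit T φ)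
    {e : X → Y} (he : Isometry e) (hs : Function.Surjective e) :
    IsMetricLimit T fun i a => e (φ i a) where
  compat i j h a := by rw [H.compat]
  dense := by
    have := hs.denseRange.dense_image he.continuous H.dense
    rw [image_iUnion] at this
    simpa only [← range_comp, Function.comp_def] using this
  exists_dist_lt i a b ε hε := by
    simpa only [he.dist_eq] using H.exists_dist_lt i a b ε hε

/-! ### Banach spaces -/

namespace BS

variable {I : Type v} [Preorder I]

/-- A system compatible with a direct system of Banach spaces is a completed direct limit of the
underlying metric spaces. -/
def IsDenseLimit {F : I ⥤ BS.{u}} (c : Cocone F) : Prop :=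
  IsMetricLimit (E := fun i => F.obj i) (X := c.pt)
    (fun _ _ h => (F.map (homOfLE h)).toLin) fun i => (c.ι.app i).toLin

theorem map_apply {F : I ⥤ BS.{u}} (c : Cocone F) {i j : I} (h : i ⟶ j) (a : F.obj i) :
    (c.ι.app j).toLin ((F.map h).toLin a) = (c.ι.app i).toLin a := by
  rw [← c.w h]; rfl

/-- Both directions of an isomorphism are contractions, so it is a surjective isometry and preserves
density and distances. This carries the metric description from the standard construction to an
arbitrary direct limit. -/
theorem IsDenseLimit.of_iso {F : I ⥤ BS.{u}} {c c' : Cocone F} (H : IsDenseLimit c)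
    (e : c ≅ c') : IsDenseLimit c' := by
  have h1 : ∀ x : c.pt, e.inv.hom.toLin (e.hom.hom.toLin x) = x := fun x => by
    have : e.hom.hom ≫ e.inv.hom = 𝟙 c.pt := by
      rw [← Cocone.category_comp_hom, e.hom_inv_id]; rfl
    exact congrArg (fun f : c.pt ⟶ c.pt => f.toLin x) this
  have h2 : ∀ x : c'.pt, e.hom.hom.toLin (e.inv.hom.toLin x) = x := fun x => by
    have : e.inv.hom ≫ e.hom.hom = 𝟙 c'.pt := by
      rw [← Cocone.category_comp_hom, e.inv_hom_id]; rfl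
    exact congrArg (fun f : c'.pt ⟶ c'.pt => f.toLin x) this
  have hiso : Isometry e.hom.hom.toLin := by
    refine AddMonoidHomClass.isometry_of_norm _ fun x => le_antisymm (e.hom.hom.norm_le x) ?_
    conv_lhs => rw [← h1 x]
    exact e.inv.hom.norm_le _
  have := IsMetricLimit.comp_isometry H hiso fun y => ⟨_, h2 y⟩
  have hw : ∀ i, c'.ι.app i = c.ι.app i ≫ e.hom.hom := fun i => (e.hom.w i).symm
  unfold IsDenseLimit
  simp only [hw]
  exact this

theorem IsDenseLimit.eq_of_comp {F : I ⥤ BS.{u}} {c : Cocone F} (H : IsDenseLimit c) {Z : BS.{u}}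
    {f g : c.pt →ₗ[ℝ] Z} (hf : ∀ x, ‖f x‖ ≤ ‖x‖) (hg : ∀ x, ‖g x‖ ≤ ‖x‖)
    (h : ∀ i (a : F.obj i), f ((c.ι.app i).toLin a) = g ((c.ι.app i).toLin a)) : f = g :=
  LinearMap.ext <| IsMetricLimit.induction H
    (isClosed_eq (BS.Hom.continuous ⟨f, hf⟩) (BS.Hom.continuous ⟨g, hg⟩)) h

variable [IsDirectedOrder I]

/-- The norm of a class can be no smaller than what the tail of a family forces: altering a family
by a null net does not affect its norms far along the index set. -/
theorem isDenseLimit_stdCocone [Nonempty I] (F : I ⥤ BS.{max u v}) :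
    IsDenseLimit (stdCocone.{v, u} F) where
  compat i j h a := map_apply _ _ _
  dense := by
    suffices Dense (⋃ i, range ((stdPhi.{v, u} F i).codRestrict _ (stdPhi_mem.{v, u} F i))) from
      this
    intro z
    rw [closure_subtype, image_iUnion]
    have hz : (z : BoundedProduct.{v, u} F ⧸ nullNets.{v, u} F) ∈
        closure (⋃ i, range (stdPhi.{v, u} F i)) := by
      rw [← coe_stdSpace]; exact z.2
    convert hz using 3
    funext i
    rw [← range_comp]; rfl
  exists_dist_lt i a b ε hε := by
    have key : ∀ x : F.obj i, ∃ (j : I) (h : i ≤ j),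
        ‖(F.map (homOfLE h)).toLin x‖ < ‖stdPhi.{v, u} F i x‖ + ε := by
      intro x
      -- A nearly norm-minimal representative `f` differs from `stdPsi F i x` by a null net. One
      -- half of `ε` pays for its norm, the other for the difference at a late index `j`.
      obtain ⟨f, hf, hlt⟩ := Submodule.Quotient.norm_mk_lt (stdPhi.{v, u} F i x) (half_pos hε)
      have hnull : stdPsi.{v, u} F i x - f ∈ nullNets.{v, u} F := (Submodule.Quotient.eq _).1 hf.symm
      have hnull' : Tendsto (fun j => ‖(stdPsi.{v, u} F i x - f) j‖) atTop (𝓝 0) := hnull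
      obtain ⟨j, hj, hij⟩ := ((hnull'.eventually_lt_const (half_pos hε)).and
        (eventually_ge_atTop i)).exists
      refine ⟨j, hij, ?_⟩
      rw [← stdPsi_of_le F hij]
      have h1 : ‖f j‖ ≤ ‖f‖ := lp.norm_apply_le_norm (by simp) f j
      have h2 := norm_le_norm_add_norm_sub' (stdPsi.{v, u} F i x j) (f j)
      have h3 : ‖stdPsi.{v, u} F i x j - f j‖ < ε / 2 := hj
      linarith
    obtain ⟨j, h, hj⟩ := key (a - b)
    refine ⟨j, h, ?_⟩
    rw [dist_eq_norm, dist_eq_norm, ← map_sub, ← map_sub]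
    exact hj

theorem IsDenseLimit.isColimit_toComMet {F : I ⥤ BS.{u}} {c : Cocone F} (H : IsDenseLimit c) :
    Nonempty (IsColimit (BS.toComMet.mapCocone c)) := by
  have key : ∀ s : Cocone (F ⋙ BS.toComMet), ∃ g : c.pt → s.pt,
      (∀ x y, dist (g x) (g y) ≤ dist x y) ∧
      ∀ i (a : F.obj i), g ((c.ι.app i).toLin a) = (s.ι.app i).toFun a := by
    intro s
    let f : ∀ i, F.obj i → s.pt := fun i => (s.ι.app i).toFun
    refine IsMetricLimit.exists_lift H f (fun i => (s.ι.app i).dist_le) fun i j h a => ?_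
    exact congrArg (fun f : ComMet.Hom _ _ => f.toFun a) (s.w (homOfLE h))
  choose g hg hgs using key
  exact ⟨{
    desc := fun s => ⟨g s, hg s⟩
    fac := fun s i => ComMet.Hom.ext (funext (hgs s i))
    uniq := fun s m hm => by
      refine ComMet.Hom.ext (funext ?_)
      have hc : ∀ f : BS.toComMet.obj c.pt ⟶ s.pt, Continuous f.toFun := fun f =>
        (LipschitzWith.of_dist_le_mul (K := 1) fun x y => by simpa using f.dist_le x y).continuous
      refine IsMetricLimit.induction H (isClosed_eq (hc m) (hc ⟨g s, hg s⟩)) fun i a => ?_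
      exact (congrArg (fun f : ComMet.Hom _ _ => f.toFun a) (hm i)).trans (hgs s i a).symm }⟩

theorem IsDenseLimit.exists_lift {F : I ⥤ BS.{u}} {c : Cocone F} (H : IsDenseLimit c)
    (s : Cocone F) : ∃ g : c.pt →ₗ[ℝ] s.pt, (∀ x, ‖g x‖ ≤ ‖x‖) ∧
      ∀ i (a : F.obj i), g ((c.ι.app i).toLin a) = (s.ι.app i).toLin a := by
  let φ : ∀ i, F.obj i →ₗ[ℝ] c.pt := fun i => (c.ι.app i).toLin
  let f : ∀ i, F.obj i →ₗ[ℝ] s.pt := fun i => (s.ι.app i).toLin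
  exact IsMetricLimit.exists_linear_lift (φ := φ) H f (fun i => (s.ι.app i).norm_le)
    fun i j h a => map_apply s _ a

theorem IsDenseLimit.isColimit {F : I ⥤ BS.{u}} {c : Cocone F} (H : IsDenseLimit c) :
    Nonempty (IsColimit c) := by
  choose g hg hgs using H.exists_lift
  exact ⟨{
    desc := fun s => ⟨g s, hg s⟩
    fac := fun s i => BS.Hom.ext (LinearMap.ext (hgs s i))
    uniq := fun s m hm => BS.Hom.ext <| H.eq_of_comp m.norm_le (hg s) fun i a =>
      (congrArg (fun f : BS.Hom _ _ => f.toLin a) (hm i)).trans (hgs s i a).symm }⟩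

end BS

noncomputable section

/-! ### The standard construction for Banach lattices -/

namespace BLLH

variable {I : Type v} [Preorder I]

section PosPart

variable (F : I ⥤ BLLH.{max u v})

/-- The coordinates of a bounded family, as elements of Banach lattices. -/
def coord (f : BoundedProduct.{v, u} (F ⋙ BLLH.toBS)) (i : I) : F.obj i := f i

/-- The coordinatewise positive part of a bounded family in a direct system of Banach lattices. -/
def posPartFamily (f : BoundedProduct.{v, u} (F ⋙ BLLH.toBS)) :
    BoundedProduct.{v, u} (F ⋙ BLLH.toBS) :=
  ⟨fun i => (coord.{v, u} F f i ⊔ 0 : F.obj i), memℓp_infty ⟨‖f‖, by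
    rintro _ ⟨i, rfl⟩
    refine le_trans ?_ (lp.norm_apply_le_norm (by simp) f i)
    have := norm_sup_sub_sup_le_norm (coord.{v, u} F f i) 0 0
    rw [sup_idem, sub_zero, sub_zero] at this
    exact this⟩⟩

theorem norm_posPartFamily_sub_apply_le (f g : BoundedProduct.{v, u} (F ⋙ BLLH.toBS)) (i : I) :
    ‖posPartFamily.{v, u} F f i - posPartFamily.{v, u} F g i‖ ≤ ‖f i - g i‖ :=
  norm_sup_sub_sup_le_norm (coord.{v, u} F f i) (coord.{v, u} F g i) 0

theorem norm_posPartFamily_sub_le (f g : BoundedProduct.{v, u} (F ⋙ BLLH.toBS)) :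
    ‖posPartFamily.{v, u} F f - posPartFamily.{v, u} F g‖ ≤ ‖f - g‖ :=
  lp.norm_le_of_forall_le (norm_nonneg _) fun i =>
    (norm_posPartFamily_sub_apply_le F f g i).trans (lp.norm_apply_le_norm (by simp) (f - g) i)

/-- The positive part is contractive in each coordinate, so it keeps null differences null and
descends to the quotient. -/
theorem mkQ_posPartFamily_eq {f g : BoundedProduct.{v, u} (F ⋙ BLLH.toBS)}
    (h : (nullNets.{v, u} (F ⋙ BLLH.toBS)).mkQ f = (nullNets.{v, u} (F ⋙ BLLH.toBS)).mkQ g) :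
    (nullNets.{v, u} (F ⋙ BLLH.toBS)).mkQ (posPartFamily.{v, u} F f) =
      (nullNets.{v, u} (F ⋙ BLLH.toBS)).mkQ (posPartFamily.{v, u} F g) := by
  have h' : Tendsto (fun i => ‖(f - g) i‖) atTop (𝓝 0) := (Submodule.Quotient.eq _).1 h
  exact (Submodule.Quotient.eq _).2 <| squeeze_zero (fun _ => norm_nonneg _)
    (norm_posPartFamily_sub_apply_le F f g) h'

theorem posPartFamily_stdPsi (i : I) (a : F.obj i) :
    posPartFamily.{v, u} F (stdPsi.{v, u} (F ⋙ BLLH.toBS) i a) =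
      stdPsi.{v, u} (F ⋙ BLLH.toBS) i (a ⊔ 0 : F.obj i) := by
  refine lp.ext (funext fun j => ?_)
  by_cases h : i ≤ j
  · have h1 := (F.map (homOfLE h)).map_sup a 0
    rw [map_zero] at h1
    have h2 := stdPsi_of_le.{v, u} (F ⋙ BLLH.toBS) h a
    exact (congrArg (fun x : F.obj j => x ⊔ 0) h2).trans
      (h1.symm.trans (stdPsi_of_le.{v, u} (F ⋙ BLLH.toBS) h _).symm)
  · have h2 := stdPsi_of_not_le.{v, u} (F ⋙ BLLH.toBS) h a
    exact (congrArg (fun x : F.obj j => x ⊔ 0) h2).trans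
      ((sup_idem (0 : F.obj j)).trans (stdPsi_of_not_le.{v, u} (F ⋙ BLLH.toBS) h _).symm)

/-- Both `p` and the coordinatewise positive part on classes are contractive, and they agree on the
dense union of the images. The lemma later identifies the abstract positive part of the limit with
the coordinatewise one. -/
theorem mkQ_posPartFamily [IsDirectedOrder I] [Nonempty I]
    {p : stdSpace.{v, u} (F ⋙ BLLH.toBS) → stdSpace.{v, u} (F ⋙ BLLH.toBS)}
    (hp : ∀ x y, ‖p x - p y‖ ≤ ‖x - y‖)
    (hpφ : ∀ i (a : F.obj i), (p ⟨_, stdPhi_mem.{v, u} (F ⋙ BLLH.toBS) i a⟩).1 =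
      stdPhi.{v, u} (F ⋙ BLLH.toBS) i (a ⊔ 0 : F.obj i))
    {f : BoundedProduct.{v, u} (F ⋙ BLLH.toBS)} {x : stdSpace.{v, u} (F ⋙ BLLH.toBS)}
    (hf : (nullNets.{v, u} (F ⋙ BLLH.toBS)).mkQ f = x.1) :
    (nullNets.{v, u} (F ⋙ BLLH.toBS)).mkQ (posPartFamily.{v, u} F f) = (p x).1 := by
  refine eq_of_forall_dist_le fun ε hε => ?_
  obtain ⟨i, a, ha⟩ := (BS.isDenseLimit_stdCocone.{v, u} (F ⋙ BLLH.toBS)).exists_dist_map_lt x (half_pos hε)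
  let y : stdSpace.{v, u} (F ⋙ BLLH.toBS) := ⟨_, stdPhi_mem.{v, u} (F ⋙ BLLH.toBS) i a⟩
  have hxy : ‖x - y‖ < ε / 2 := (dist_eq_norm x y).symm.trans_lt ha
  -- The slack `ε / 2 - ‖x - y‖` yields a lift `m` of `x - y` with `‖m‖ < ε / 2`, and `stdPsi i a +
  -- m` then represents `x`.
  obtain ⟨m, hm, hlt⟩ := Submodule.Quotient.norm_mk_lt (x.1 - y.1) (sub_pos.2 hxy)
  have hm' : ‖m‖ < ε / 2 := by
    have : ‖x.1 - y.1‖ = ‖x - y‖ := rfl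
    linarith
  have h1 : (nullNets.{v, u} (F ⋙ BLLH.toBS)).mkQ f = (nullNets.{v, u} (F ⋙ BLLH.toBS)).mkQ (stdPsi.{v, u} (F ⋙ BLLH.toBS) i a + m) := by
    have h2 : (nullNets.{v, u} (F ⋙ BLLH.toBS)).mkQ m = x.1 - y.1 := hm
    rw [map_add, h2, hf]
    exact (add_sub_cancel y.1 x.1).symm
  rw [mkQ_posPartFamily_eq F h1, dist_eq_norm]
  have h3 : ‖(nullNets.{v, u} (F ⋙ BLLH.toBS)).mkQ (posPartFamily.{v, u} F (stdPsi.{v, u} (F ⋙ BLLH.toBS) i a + m)) -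
      (p y).1‖ ≤ ‖m‖ := by
    have : (p y).1 = (nullNets.{v, u} (F ⋙ BLLH.toBS)).mkQ (posPartFamily.{v, u} F (stdPsi.{v, u} (F ⋙ BLLH.toBS) i a)) := by
      exact (hpφ i a).trans (congrArg (nullNets.{v, u} (F ⋙ BLLH.toBS)).mkQ
        (posPartFamily_stdPsi F i a)).symm
    rw [this, ← map_sub]
    refine (Submodule.Quotient.norm_mk_le _ _).trans ((norm_posPartFamily_sub_le F _ _).trans ?_)
    rw [add_sub_cancel_left]
  have h4 : ‖(p x).1 - (p y).1‖ < ε / 2 := (hp x y).trans_lt hxy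
  rw [norm_sub_rev] at h4
  have h5 := norm_add_le ((nullNets.{v, u} (F ⋙ BLLH.toBS)).mkQ
    (posPartFamily.{v, u} F (stdPsi.{v, u} (F ⋙ BLLH.toBS) i a + m)) - (p y).1) ((p y).1 - (p x).1)
  rw [sub_add_sub_cancel] at h5
  linarith

end PosPart

theorem exists_isStandardLattice [IsDirectedOrder I] [Nonempty I] (F : I ⥤ BLLH.{max u v}) :
    ∃ c : Cocone F, BS.IsDenseLimit (BLLH.toBS.mapCocone c) ∧ IsStandardLattice.{v, u} c := by
  let d := stdCocone.{v, u} (F ⋙ BLLH.toBS)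
  have H := BS.isDenseLimit_stdCocone.{v, u} (F ⋙ BLLH.toBS)
  let T : ∀ ⦃i j : I⦄, i ≤ j → F.obj i →ₗ[ℝ] F.obj j := fun i j h => (F.map (homOfLE h)).toLin
  let φ : ∀ i, F.obj i →ₗ[ℝ] d.pt := fun i => (d.ι.app i).toLin
  obtain ⟨L, hadd, hmod, hsolid, hsup, hinf⟩ := IsMetricLimit.exists_lattice (T := T) (φ := φ) H
    (fun i => (d.ι.app i).norm_le) fun i j h a => by
      have := (F.map (homOfLE h)).map_sup a 0
      rw [map_zero] at this
      exact this
  let X : BLLH.{max u v} := { carrier := d.pt }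
  let c : Cocone F :=
    { pt := X
      ι :=
        { app := fun i => ⟨φ i, (d.ι.app i).norm_le, hsup i, hinf i⟩
          naturality := fun i j h => BLLH.Hom.ext <| LinearMap.ext fun a =>
            BS.map_apply d h a } }
  have hpos : ∀ (f : BoundedProduct.{v, u} (F ⋙ BLLH.toBS)) (x : X),
      (nullNets.{v, u} (F ⋙ BLLH.toBS)).mkQ f = x.1 →
      (nullNets.{v, u} (F ⋙ BLLH.toBS)).mkQ (posPartFamily.{v, u} F f) = (x ⊔ 0 : X).1 :=
    fun f x hf => mkQ_posPartFamily F (p := fun x : X => (x ⊔ 0 : X))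
      (fun x y => norm_sup_sub_sup_le_norm (α := X) x y 0)
      (fun i a => congrArg Subtype.val
        (show (φ i a ⊔ 0 : X) = φ i (a ⊔ 0) by rw [hsup, map_zero])) hf
  refine ⟨c, H, Iso.refl d, fun x y => ?_⟩
  change LE.le (α := X) x y ↔ ∃ f g : BoundedProduct.{v, u} (F ⋙ BLLH.toBS),
      (∀ i, LE.le (α := F.obj i) (f i) (g i)) ∧
      (nullNets.{v, u} (F ⋙ BLLH.toBS)).mkQ f = x.1 ∧
      (nullNets.{v, u} (F ⋙ BLLH.toBS)).mkQ g = y.1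
  constructor
  · intro hxy
    obtain ⟨f, hf⟩ := Submodule.mkQ_surjective (nullNets.{v, u} (F ⋙ BLLH.toBS)) x.1
    obtain ⟨g, hg⟩ := Submodule.mkQ_surjective (nullNets.{v, u} (F ⋙ BLLH.toBS)) y.1
    -- An arbitrary lift `g` of `y` need not dominate `f`, but `f + (g - f)⁺` does. Its class is `x
    -- + (y - x)⁺`, which is `y` because `x ≤ y`.
    refine ⟨f, f + posPartFamily.{v, u} F (g - f), fun i => ?_, hf, ?_⟩
    · exact le_add_of_nonneg_right (a := coord.{v, u} F f i)
        (le_sup_right (a := coord.{v, u} F (g - f) i))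
    · have h1 := hpos (g - f) (y - x : X) (by rw [map_sub, hf, hg]; rfl)
      have h2 : ((y - x : X) ⊔ 0 : X) = (y - x : X) := sup_eq_left.2 (sub_nonneg.2 hxy)
      rw [map_add, hf, h1, h2]
      exact add_sub_cancel x.1 y.1
  · rintro ⟨f, g, hfg, hf, hg⟩
    have h1 := hpos (g - f) (y - x : X) (by rw [map_sub, hf, hg]; rfl)
    -- Conversely, a coordinatewise nonnegative family is its own positive part, hence so is its
    -- class `y - x`.
    have h2 : posPartFamily.{v, u} F (g - f) = g - f := by
      refine lp.ext (funext fun i => ?_)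
      exact sup_eq_left (α := F.obj i).2 (sub_nonneg (α := F.obj i).2 (hfg i))
    have h3 : (y - x : X) = (y - x : X) ⊔ 0 := by
      apply Subtype.ext
      rw [← h1, h2, map_sub, hf, hg]; rfl
    exact sub_nonneg.1 (h3 ▸ le_sup_right : (0 : X) ≤ (y - x : X))

end BLLH

end

/-! ### Universal properties for Banach lattices. -/

namespace BLLH

variable {I : Type v} [Preorder I]

theorem map_apply {F : I ⥤ BLLH.{u}} (c : Cocone F) {i j : I} (h : i ⟶ j) (a : F.obj i) :
    (c.ι.app j).toLin ((F.map h).toLin a) = (c.ι.app i).toLin a := by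
  rw [← c.w h]; rfl

theorem image_mono {F : I ⥤ BLLH.{u}} (c : Cocone F) {i j : I} (h : i ≤ j) :
    BLLH.image c i ⊆ BLLH.image c j := by
  rintro _ ⟨a, rfl⟩
  exact ⟨_, map_apply c (homOfLE h) a⟩

theorem isVectorSublattice_image {F : I ⥤ BLLH.{u}} (c : Cocone F) (i : I) :
    IsVectorSublattice (BLLH.image c i) := by
  refine ⟨⟨LinearMap.range (c.ι.app i).toLin, rfl⟩, ?_⟩
  rintro _ ⟨a, rfl⟩ _ ⟨b, rfl⟩
  exact ⟨⟨a ⊔ b, (c.ι.app i).map_sup a b⟩, ⟨a ⊓ b, (c.ι.app i).map_inf a b⟩⟩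

variable [IsDirectedOrder I]

/-- A completed direct limit of Banach lattices is a colimit in the category of preordered Banach
spaces. -/
theorem isColimit_toPOBS {F : I ⥤ BLLH.{u}} {c : Cocone F}
    (H : BS.IsDenseLimit (BLLH.toBS.mapCocone c)) :
    Nonempty (IsColimit (BLLH.toPOBS.mapCocone c)) := by
  have key : ∀ s : Cocone (F ⋙ BLLH.toPOBS), ∃ g : c.pt →ₗ[ℝ] s.pt, (∀ x, ‖g x‖ ≤ ‖x‖) ∧
      (∀ x, 0 ≤ x → 0 ≤ g x) ∧ ∀ i (a : F.obj i), g ((c.ι.app i).toLin a) = (s.ι.app i).toLin a := by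
    intro s
    obtain ⟨g, hg, hgs⟩ := H.exists_lift (POBS.toBS.mapCocone s)
    refine ⟨g, hg, fun x hx => ?_, hgs⟩
    let φ : ∀ i, F.obj i →ₗ[ℝ] c.pt := fun i => (c.ι.app i).toLin
    refine IsMetricLimit.lift_nonneg (X := c.pt) (φ := φ) H (fun i => (c.ι.app i).map_sup)
      s.pt.isClosed_nonneg (BS.Hom.continuous ⟨g, hg⟩) (fun i a ha => ?_) hx
    exact le_of_le_of_eq ((s.ι.app i).nonneg a ha) (hgs i a).symm
  choose g hg hpos hgs using key
  exact ⟨{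
    desc := fun s => ⟨g s, hg s, hpos s⟩
    fac := fun s i => POBS.Hom.ext (LinearMap.ext (hgs s i))
    uniq := fun s m hm => POBS.Hom.ext <| H.eq_of_comp (Z := POBS.toBS.obj s.pt) m.norm_le (hg s)
      fun i a => (congrArg (fun f : POBS.Hom _ _ => f.toLin a) (hm i)).trans (hgs s i a).symm }⟩

/-- The Banach space factorisation already preserves suprema and infima on the images, and by
continuity it does so everywhere. -/
theorem exists_lift {F : I ⥤ BLLH.{u}} {c : Cocone F}
    (H : BS.IsDenseLimit (BLLH.toBS.mapCocone c)) (s : Cocone F) :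
    ∃ g : c.pt ⟶ s.pt, ∀ i (a : F.obj i), g.toLin ((c.ι.app i).toLin a) = (s.ι.app i).toLin a := by
  obtain ⟨g, hg, hgs⟩ := H.exists_lift (BLLH.toBS.mapCocone s)
  let φ : ∀ i, F.obj i →ₗ[ℝ] c.pt := fun i => (c.ι.app i).toLin
  let f : ∀ i, F.obj i →ₗ[ℝ] s.pt := fun i => (s.ι.app i).toLin
  let g' : c.pt →ₗ[ℝ] s.pt := g
  have hg' : Continuous g' := BS.Hom.continuous ⟨g, hg⟩
  have hgs' : ∀ i a, g' (φ i a) = f i a := hgs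
  refine ⟨⟨g', hg, ?_, ?_⟩, hgs⟩
  · exact IsMetricLimit.lift_sup (X := c.pt) (φ := φ) H (fun i => (c.ι.app i).map_sup) hg'
      fun i a b => by rw [hgs', hgs', hgs']; exact (s.ι.app i).map_sup a b
  · exact IsMetricLimit.lift_inf (X := c.pt) (φ := φ) H (fun i => (c.ι.app i).map_inf) hg'
      fun i a b => by rw [hgs', hgs', hgs']; exact (s.ι.app i).map_inf a b

/-- A completed direct limit of Banach lattices is a colimit in the category of Banach lattices and
contractive lattice homomorphisms. -/
theorem isColimit {F : I ⥤ BLLH.{u}} {c : Cocone F}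
    (H : BS.IsDenseLimit (BLLH.toBS.mapCocone c)) : Nonempty (IsColimit c) := by
  choose g hgs using exists_lift H
  exact ⟨{
    desc := g
    fac := fun s i => BLLH.Hom.ext (LinearMap.ext (hgs s i))
    uniq := fun s m hm => BLLH.Hom.ext <|
      H.eq_of_comp (Z := BLLH.toBS.obj s.pt) m.norm_le (g s).norm_le
      fun i a => (congrArg (fun f : BLLH.Hom _ _ => f.toLin a) (hm i)).trans (hgs s i a).symm }⟩

end BLLH

namespace BLAIPLH

variable {I : Type v} [Preorder I] [IsDirectedOrder I]

/-- A completed direct limit of Banach lattices is a colimit in the category of Banach lattices and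
contractive almost interval preserving lattice homomorphisms. -/
theorem isColimit {F : I ⥤ BLAIPLH.{u}} {c : Cocone F}
    (H : BS.IsDenseLimit (BLLH.toBS.mapCocone (BLAIPLH.toLH.mapCocone c))) :
    Nonempty (IsColimit c) := by
  have key : ∀ s : Cocone F, ∃ g : c.pt ⟶ s.pt, ∀ i (a : F.obj i),
      g.toHom.toLin ((c.ι.app i).toHom.toLin a) = (s.ι.app i).toHom.toLin a := by
    intro s
    obtain ⟨g, hgs⟩ := BLLH.exists_lift H (BLAIPLH.toLH.mapCocone s)
    let φ : ∀ i, F.obj i →ₗ[ℝ] c.pt := fun i => (c.ι.app i).toHom.toLin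
    let f : ∀ i, F.obj i →ₗ[ℝ] s.pt := fun i => (s.ι.app i).toHom.toLin
    let g' : c.pt →ₗ[ℝ] s.pt := g.toLin
    have hgs' : ∀ i, g' ∘ₗ φ i = f i := fun i => LinearMap.ext (hgs i)
    refine ⟨⟨g, ?_⟩, hgs⟩
    exact IsMetricLimit.lift_almostIntervalPreserving (X := c.pt) (φ := φ) (g := g') H
      (fun i => (c.ι.app i).toHom.map_sup) g.norm_le g.map_sup
      fun i => by rw [hgs']; exact (s.ι.app i).aip
  choose g hgs using key
  exact ⟨{
    desc := g
    fac := fun s i => BLAIPLH.Hom.ext (BLLH.Hom.ext (LinearMap.ext (hgs s i)))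
    uniq := fun s m hm => BLAIPLH.Hom.ext <| BLLH.Hom.ext <|
      H.eq_of_comp (Z := BLLH.toBS.obj s.pt.toBLLH) m.toHom.norm_le (g s).toHom.norm_le
      fun i a => (congrArg (fun f : BLAIPLH.Hom _ _ => f.toHom.toLin a) (hm i)).trans
        (hgs s i a).symm }⟩

/-- A completed direct limit, in the category of Banach lattices and lattice homomorphisms, of a
direct system of almost interval preserving lattice homomorphisms lifts to `BLAIPLH`. -/
theorem exists_mapCocone_eq {F : I ⥤ BLAIPLH.{u}} (c : Cocone (F ⋙ BLAIPLH.toLH))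
    (H : BS.IsDenseLimit (BLLH.toBS.mapCocone c)) :
    ∃ d : Cocone F, BLAIPLH.toLH.mapCocone d = c := by
  let T : ∀ ⦃i j : I⦄, i ≤ j → F.obj i →ₗ[ℝ] F.obj j :=
    fun i j h => (F.map (homOfLE h)).toHom.toLin
  let φ : ∀ i, F.obj i →ₗ[ℝ] c.pt := fun i => (c.ι.app i).toLin
  have haip : ∀ i, AlmostIntervalPreserving (φ i) :=
    IsMetricLimit.almostIntervalPreserving (T := T) (φ := φ) H (fun i => (c.ι.app i).norm_le)
      (fun i => (c.ι.app i).map_sup) (fun i => (c.ι.app i).map_inf)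
      fun i j h => (F.map (homOfLE h)).aip
  exact ⟨{
    pt := ⟨c.pt⟩
    ι :=
      { app := fun i => ⟨c.ι.app i, haip i⟩
        naturality := fun i j h => BLAIPLH.Hom.ext (c.ι.naturality h) } }, rfl⟩

end BLAIPLH

/-! ### Transfer from the standard construction to all direct limits. -/

theorem mainTheorem1 {I : Type v} [Preorder I] [IsDirectedOrder I] [Nonempty I] :
    -- Banach lattices and contractive almost interval preserving lattice homomorphisms
    (∀ F : I ⥤ BLAIPLH.{max u v},
      (∃ c : Cocone F, Nonempty (IsColimit c) ∧
        IsStandardLattice.{v, u} (BLAIPLH.toLH.mapCocone c)) ∧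
      ∀ c : Cocone F, Nonempty (IsColimit c) →
        closure (⋃ i, BLAIPLH.image c i) = univ ∧
        (∀ i j, i ≤ j → BLAIPLH.image c i ⊆ BLAIPLH.image c j) ∧
        (∀ i, IsVectorSublattice (BLAIPLH.image c i)) ∧
        (∀ i, IsVectorLatticeIdeal (closure (BLAIPLH.image c i))) ∧
        Nonempty (IsColimit (BLAIPLH.toLH.mapCocone c)) ∧
        Nonempty (IsColimit ((BLAIPLH.toLH ⋙ BLLH.toPOBS).mapCocone c)) ∧
        Nonempty (IsColimit ((BLAIPLH.toLH ⋙ BLLH.toPOBS ⋙ POBS.toBS).mapCocone c)) ∧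
        Nonempty (IsColimit
          ((BLAIPLH.toLH ⋙ BLLH.toPOBS ⋙ POBS.toBS ⋙ BS.toComMet).mapCocone c))) ∧
    -- Banach lattices and contractive lattice homomorphisms
    (∀ F : I ⥤ BLLH.{max u v},
      (∃ c : Cocone F, Nonempty (IsColimit c) ∧ IsStandardLattice.{v, u} c) ∧
      ∀ c : Cocone F, Nonempty (IsColimit c) →
        closure (⋃ i, BLLH.image c i) = univ ∧
        (∀ i j, i ≤ j → BLLH.image c i ⊆ BLLH.image c j) ∧
        (∀ i, IsVectorSublattice (BLLH.image c i)) ∧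
        Nonempty (IsColimit (BLLH.toPOBS.mapCocone c)) ∧
        Nonempty (IsColimit ((BLLH.toPOBS ⋙ POBS.toBS).mapCocone c)) ∧
        Nonempty (IsColimit ((BLLH.toPOBS ⋙ POBS.toBS ⋙ BS.toComMet).mapCocone c))) ∧
    -- Banach spaces and contractions
    (∀ F : I ⥤ BS.{max u v},
      Nonempty (IsColimit (stdCocone.{v, u} F)) ∧
      ∀ c : Cocone F, Nonempty (IsColimit c) →
        closure (⋃ i, BS.image c i) = univ ∧
        (∀ i j, i ≤ j → BS.image c i ⊆ BS.image c j) ∧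
        (∀ i, IsLinearSubspace (BS.image c i)) ∧
        Nonempty (IsColimit (BS.toComMet.mapCocone c))) := by
  refine ⟨fun F => ?_, fun F => ?_, fun F => ?_⟩
  · obtain ⟨c₀, H₀, hstd⟩ := BLLH.exists_isStandardLattice.{v, u} (F ⋙ BLAIPLH.toLH)
    -- The standard system is built with lattice homomorphisms only; its structure maps turn out to
    -- be almost interval preserving, so it already lives in the smaller category.
    obtain ⟨d, rfl⟩ := BLAIPLH.exists_mapCocone_eq c₀ H₀
    refine ⟨⟨d, BLAIPLH.isColimit H₀, hstd⟩, ?_⟩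
    rintro c ⟨hc⟩
    obtain ⟨hd⟩ := BLAIPLH.isColimit H₀
    have H : BS.IsDenseLimit (BLLH.toBS.mapCocone (BLAIPLH.toLH.mapCocone c)) :=
      -- Uniqueness of colimits gives an isomorphism in the smallest category; its image among
      -- Banach spaces carries the metric description to `c`, from which all remaining claims are
      -- read off.
      H₀.of_iso ((Cocone.functoriality F (BLAIPLH.toLH ⋙ BLLH.toBS)).mapIso
        (hd.uniqueUpToIso hc))
    exact ⟨H.dense.closure_eq, fun i j => BLLH.image_mono (BLAIPLH.toLH.mapCocone c),
      BLLH.isVectorSublattice_image (BLAIPLH.toLH.mapCocone c),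
      fun i => (c.ι.app i).aip.isVectorLatticeIdeal_closure_range (c.ι.app i).toHom.map_sup,
      BLLH.isColimit H, BLLH.isColimit_toPOBS H, H.isColimit, H.isColimit_toComMet⟩
  · obtain ⟨d, H₀, hstd⟩ := BLLH.exists_isStandardLattice.{v, u} F
    refine ⟨⟨d, BLLH.isColimit H₀, hstd⟩, ?_⟩
    rintro c ⟨hc⟩
    obtain ⟨hd⟩ := BLLH.isColimit H₀
    have H : BS.IsDenseLimit (BLLH.toBS.mapCocone c) :=
      H₀.of_iso ((Cocone.functoriality F BLLH.toBS).mapIso (hd.uniqueUpToIso hc))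
    exact ⟨H.dense.closure_eq, fun i j => BLLH.image_mono c, BLLH.isVectorSublattice_image c,
      BLLH.isColimit_toPOBS H, H.isColimit, H.isColimit_toComMet⟩
  · have H₀ := BS.isDenseLimit_stdCocone.{v, u} F
    refine ⟨H₀.isColimit, ?_⟩
    rintro c ⟨hc⟩
    obtain ⟨hd⟩ := H₀.isColimit
    have H : BS.IsDenseLimit c := H₀.of_iso (hd.uniqueUpToIso hc)
    refine ⟨H.dense.closure_eq, fun i j h => ?_, fun i => ⟨LinearMap.range (c.ι.app i).toLin, rfl⟩,
      H.isColimit_toComMet⟩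
    rintro _ ⟨a, rfl⟩
    exact ⟨_, BS.map_apply c (homOfLE h) a⟩
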